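/- Let $n\ge 1$ and let $\mathfrak F=\bigoplus_{k\ge 0}(\mathbb C^n)^{\otimes k}$ be the full Fock space, with orthonormal basis $(e_w)$ indexed by the words $w$ in the letters $1,\dots,n$. Let $L_i\xi=e_i\otimes\xi$ be the left creation operators, write $L[\zeta]=\sum_{i=1}^n\zeta_iL_i$ for $\zeta\in\mathbb C^n$, and $L_w=L_{i_1}\cdots L_{i_k}$ for $w=i_1\cdots i_k$. Let $\mathfrak L_n$ be the noncommutative analytic Toeplitz algebra, i.e. the smallest unital subalgebra of $\mathcal L(\mathfrak F)$ that contains $L_1,\dots,L_n$ and is closed in the weak operator topology (WOT). Let $\mathfrak C$ be its commutator ideal, i.e. the smallest WOT-closed two-sided ideal of $\mathfrak L_n$ containing all $AB-BA$ with $A,B\in\mathfrak L_n$. Let $U(1,n)$ be the group of complex $(n+1)\times(n+1)$ matrices $X=\begin{pmatrix}x&y\\ z^t&X'\end{pmatrix}$ with $X^*\,\mathrm{diag}(-1,1,\dots,1)\,X=\mathrm{diag}(-1,1,\dots,1)$, where $x\in\mathbb C$ and $y,z$ are rows of length $n$. For $X\in U(1,n)$ the Voiculescu automorphism $\Phi_X$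 of $\mathfrak L_n$ is $\Phi_X(A)=U_XAU_X^*$, where $U_X$ is the unitary operator on $\mathfrak F$ determined by $U_Xe_w=\Phi_X(L_{i_1})\cdots\Phi_X(L_{i_k})(xI-L[z])^{-1}e_\emptyset$ for every word $w=i_1\cdots i_k$; here $\Phi_X(L_i)=(xI-L[z])^{-1}(L[X'\varepsilon_i]-y_iI)$, with $\varepsilon_i$ the $i$-th standard basis vector of $\mathbb C^n$. Theorem. Let $\mathfrak J$ be a WOT-closed two-sided ideal of $\mathfrak L_n$ with $\mathfrak C\subseteq\mathfrak J$. If $\Phi_X(\mathfrak J)=\mathfrak J$ for all $X\in U(1,n)$, then $\mathfrak J=\mathfrak C$ or $\mathfrak J=\mathfrak L_n$. -/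

import Mathlib

open scoped InnerProductSpace Matrix

noncomputable section

namespace FockSpace

/-- The full Fock space of `ℂⁿ`, realized as `ℓ²` of the set of words in the letters `Fin n`:
the basis vector of the word `[i₁, …, i_k]` is `e_{i₁} ⊗ ⋯ ⊗ e_{i_k}`. -/
abbrev Fock (n : ℕ) : Type := lp (fun _ : List (Fin n) => ℂ) 2

/-- The orthonormal basis vector `e_w` of the Fock space. -/
def basisVec {n : ℕ} (w : List (Fin n)) : Fock n := lp.single 2 w (1 : ℂ)

/-- The vacuum vector `e_∅`. -/
def vacuum (n : ℕ) : Fock n := basisVec []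

theorem inner_basisVec {n : ℕ} (u w : List (Fin n)) :
    ⟪basisVec u, basisVec w⟫_ℂ = if u = w then 1 else 0 := by
  unfold basisVec
  rw [lp.inner_single_left, lp.single_apply, Pi.single_apply]
  split_ifs <;> simp

/-- The isometry of the Fock space that sends `e_w` to `v w`, for an orthonormal family `v`
indexed by words. -/
def isometryOfFamily {n : ℕ} (v : List (Fin n) → Fock n) (hv : Orthonormal ℂ v) :
    Fock n →ₗᵢ[ℂ] Fock n :=
  hv.orthogonalFamily.linearIsometry

theorem isometryOfFamily_basisVec {n : ℕ} (v : List (Fin n) → Fock n) (hv : Orthonormal ℂ v)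
    (w : List (Fin n)) : isometryOfFamily v hv (basisVec w) = v w := by
  unfold isometryOfFamily basisVec
  rw [OrthogonalFamily.linearIsometry_apply_single]
  simp

theorem inner_isometryOfFamily_eq_zero {n : ℕ} (v : List (Fin n) → Fock n)
    (hv : Orthonormal ℂ v) (x ξ : Fock n) (h : ∀ w, ⟪x, v w⟫_ℂ = 0) :
    ⟪x, isometryOfFamily v hv ξ⟫_ℂ = 0 := by
  have h1 := (hv.orthogonalFamily.hasSum_linearIsometry ξ).mapL (innerSL ℂ x)
  have h2 : (fun w => innerSL ℂ x (LinearIsometry.toSpanSingleton ℂ (Fock n) (hv.1 w) (ξ w)))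
      = fun _ => (0 : ℂ) := by
    funext w
    simp [h]
  rw [h2] at h1
  exact h1.unique hasSum_zero

theorem orthonormal_cons {n : ℕ} (i : Fin n) :
    Orthonormal ℂ (fun w : List (Fin n) => basisVec (i :: w)) := by
  rw [orthonormal_iff_ite]
  intro u w
  simp [inner_basisVec]

/-- The left creation operator `L_i ξ = e_i ⊗ ξ`, that is, `L_i e_w = e_{iw}`. -/
def creation {n : ℕ} (i : Fin n) : Fock n →L[ℂ] Fock n :=
  (isometryOfFamily (fun w => basisVec (i :: w)) (orthonormal_cons i)).toContinuousLinearMap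

/-- `L[ζ] = ∑ ζ_i L_i`. -/
def creationVec {n : ℕ} (ζ : Fin n → ℂ) : Fock n →L[ℂ] Fock n := ∑ i, ζ i • creation i

theorem inner_creation {n : ℕ} (i j : Fin n) (ξ η : Fock n) :
    ⟪creation i ξ, creation j η⟫_ℂ = if i = j then ⟪ξ, η⟫_ℂ else 0 := by
  split_ifs with h
  · subst h
    exact (isometryOfFamily (fun w => basisVec (i :: w)) (orthonormal_cons i)).inner_map_map ξ η
  · refine inner_isometryOfFamily_eq_zero _ (orthonormal_cons j) _ _ fun w => ?_
    rw [inner_eq_zero_symm]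
    refine inner_isometryOfFamily_eq_zero _ (orthonormal_cons i) _ _ fun u => ?_
    simp [inner_basisVec, Ne.symm h]

theorem inner_vacuum_creation {n : ℕ} (i : Fin n) (ξ : Fock n) :
    ⟪vacuum n, creation i ξ⟫_ℂ = 0 := by
  refine inner_isometryOfFamily_eq_zero _ (orthonormal_cons i) _ _ fun u => ?_
  simp [vacuum, inner_basisVec]

theorem inner_creation_vacuum {n : ℕ} (i : Fin n) (ξ : Fock n) :
    ⟪creation i ξ, vacuum n⟫_ℂ = 0 := by
  rw [inner_eq_zero_symm]
  exact inner_vacuum_creation i ξ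

/-! ### The noncommutative analytic Toeplitz algebra and its commutator ideal -/

/-- A set of operators is closed in the weak operator topology. -/
def IsWOTClosed {n : ℕ} (S : Set (Fock n →L[ℂ] Fock n)) : Prop :=
  IsClosed (ContinuousLinearMapWOT.toCLM ⁻¹' S : Set (Fock n →WOT[ℂ] Fock n))

/-- The noncommutative analytic Toeplitz algebra `𝔏_n`: the smallest unital algebra of operators
that is closed in the weak operator topology and contains the left creation operators. -/
def toeplitzAlgebra (n : ℕ) : Subalgebra ℂ (Fock n →L[ℂ] Fock n) :=
  sInf {A | IsWOTClosed (A : Set (Fock n →L[ℂ] Fock n)) ∧ ∀ i, creation i ∈ A}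

/-- The operators on the Fock space that belong to a two-sided ideal of `𝔏_n`. -/
def idealOperators {n : ℕ} (J : TwoSidedIdeal (toeplitzAlgebra n)) :
    Set (Fock n →L[ℂ] Fock n) :=
  Subtype.val '' {A : toeplitzAlgebra n | A ∈ J}

/-- The commutator ideal `ℭ`: the smallest two-sided ideal of `𝔏_n` that is closed in the weak
operator topology and contains all commutators. -/
def commutatorIdeal (n : ℕ) : TwoSidedIdeal (toeplitzAlgebra n) :=
  sInf {J | IsWOTClosed (idealOperators J) ∧ ∀ A B : toeplitzAlgebra n, A * B - B * A ∈ J}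

/-! ### The group `U(1,n)` and the Voiculescu automorphisms -/

/-- The signature matrix `diag(-1, 1, …, 1)`. -/
def signatureMatrix (n : ℕ) : Matrix (Fin (n + 1)) (Fin (n + 1)) ℂ :=
  Matrix.diagonal (Fin.cons (-1) fun _ => 1)

/-- `X ∈ U(1,n)`. The blocks of `X` are `x = X 0 0`, `y = (X 0 j.succ)_j`, `z = (X i.succ 0)_i`
and `X' = (X i.succ j.succ)_{i,j}`. -/
def IsJUnitary {n : ℕ} (X : Matrix (Fin (n + 1)) (Fin (n + 1)) ℂ) : Prop :=
  Xᴴ * signatureMatrix n * X = signatureMatrix n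

/-- `(x I - L[z])⁻¹`. -/
def voiculescuResolvent {n : ℕ} (X : Matrix (Fin (n + 1)) (Fin (n + 1)) ℂ) :
    Fock n →L[ℂ] Fock n :=
  Ring.inverse (X 0 0 • 1 - creationVec fun i => X i.succ 0)

/-- `(x I - L[z])⁻¹ (L[X' e_i] - y_i I)`, the image of the generator `L_i`. -/
def voiculescuGenerator {n : ℕ} (X : Matrix (Fin (n + 1)) (Fin (n + 1)) ℂ) (i : Fin n) :
    Fock n →L[ℂ] Fock n :=
  voiculescuResolvent X * (creationVec (fun j => X j.succ i.succ) - X 0 i.succ • 1)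

/-- For `w = i₁ ⋯ i_k`, the vector `Φ_X(L_{i₁}) ⋯ Φ_X(L_{i_k}) (x I - L[z])⁻¹ e_∅`. -/
def voiculescuVec {n : ℕ} (X : Matrix (Fin (n + 1)) (Fin (n + 1)) ℂ) (w : List (Fin n)) :
    Fock n :=
  (w.map (voiculescuGenerator X)).prod (voiculescuResolvent X (vacuum n))

theorem jUnitary_entries {n : ℕ} {X : Matrix (Fin (n + 1)) (Fin (n + 1)) ℂ} (hX : IsJUnitary X)
    (b c : Fin (n + 1)) :
    -(star (X 0 b) * X 0 c) + ∑ j : Fin n, star (X j.succ b) * X j.succ c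
      = signatureMatrix n b c := by
  have h := congrFun (congrFun hX b) c
  rw [← h, Matrix.mul_apply, Fin.sum_univ_succ]
  simp [signatureMatrix, Matrix.mul_diagonal, Matrix.conjTranspose_apply]

/-- `U(1,n)` preserves the indefinite form, for vectors with entries in the Fock space. -/
theorem jUnitary_inner {n : ℕ} {X : Matrix (Fin (n + 1)) (Fin (n + 1)) ℂ} (hX : IsJUnitary X)
    (G H : Fin (n + 1) → Fock n) :
    -⟪∑ b, X 0 b • G b, ∑ c, X 0 c • H c⟫_ℂ
        + ∑ j : Fin n, ⟪∑ b, X j.succ b • G b, ∑ c, X j.succ c • H c⟫_ℂ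
      = -⟪G 0, H 0⟫_ℂ + ∑ i : Fin n, ⟪G i.succ, H i.succ⟫_ℂ := by
  have h1 : ∀ a : Fin (n + 1), ⟪∑ b, X a b • G b, ∑ c, X a c • H c⟫_ℂ
      = ∑ b, ∑ c, star (X a b) * X a c * ⟪G b, H c⟫_ℂ := by
    intro a
    rw [sum_inner]
    simp only [inner_sum, inner_smul_left, inner_smul_right]
    refine Finset.sum_congr rfl fun b _ => ?_
    refine Finset.sum_congr rfl fun c _ => ?_
    simp only [RCLike.star_def]
    ring
  simp only [h1]
  have h2 : ∑ j : Fin n, ∑ b, ∑ c, star (X j.succ b) * X j.succ c * ⟪G b, H c⟫_ℂ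
      = ∑ b, ∑ c, (∑ j : Fin n, star (X j.succ b) * X j.succ c) * ⟪G b, H c⟫_ℂ := by
    rw [Finset.sum_comm]
    refine Finset.sum_congr rfl fun b _ => ?_
    rw [Finset.sum_comm]
    simp only [Finset.sum_mul]
  rw [h2, ← Finset.sum_neg_distrib, ← Finset.sum_add_distrib]
  have h3 : ∀ b : Fin (n + 1), -(∑ c, star (X 0 b) * X 0 c * ⟪G b, H c⟫_ℂ)
      + ∑ c, (∑ j : Fin n, star (X j.succ b) * X j.succ c) * ⟪G b, H c⟫_ℂ
      = signatureMatrix n b b * ⟪G b, H b⟫_ℂ := by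
    intro b
    rw [← Finset.sum_neg_distrib, ← Finset.sum_add_distrib, Finset.sum_eq_single b]
    · rw [← jUnitary_entries hX b b]; ring
    · intro c _ hc
      have := jUnitary_entries hX b c
      rw [signatureMatrix, Matrix.diagonal_apply_ne _ hc.symm] at this
      rw [← neg_mul, ← add_mul, this, zero_mul]
    · simp
  simp only [h3]
  rw [Fin.sum_univ_succ]
  simp [signatureMatrix]

theorem norm_creationVec_sq {n : ℕ} (ζ : Fin n → ℂ) (ξ : Fock n) :
    ‖creationVec ζ ξ‖ ^ 2 = (∑ i, ‖ζ i‖ ^ 2) * ‖ξ‖ ^ 2 := by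
  have h : ⟪creationVec ζ ξ, creationVec ζ ξ⟫_ℂ = ((∑ i, ‖ζ i‖ ^ 2 : ℝ) : ℂ) * ⟪ξ, ξ⟫_ℂ := by
    simp only [creationVec, sum_apply, smul_apply,
      sum_inner, inner_sum, inner_smul_left, inner_smul_right, inner_creation]
    push_cast
    rw [Finset.sum_mul]
    refine Finset.sum_congr rfl fun i _ => ?_
    simp [← mul_assoc, Complex.mul_conj']
  rw [inner_self_eq_norm_sq_to_K, inner_self_eq_norm_sq_to_K] at h
  exact Complex.ofReal_injective (by push_cast at h ⊢; exact h)

theorem isUnit_voiculescu {n : ℕ} {X : Matrix (Fin (n + 1)) (Fin (n + 1)) ℂ}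
    (hX : IsJUnitary X) :
    IsUnit (X 0 0 • (1 : Fock n →L[ℂ] Fock n) - creationVec fun i => X i.succ 0) := by
  have h0 := jUnitary_entries hX 0 0
  have h1 : ∑ i : Fin n, ‖X i.succ 0‖ ^ 2 = ‖X 0 0‖ ^ 2 - 1 := by
    have : ((∑ i : Fin n, ‖X i.succ 0‖ ^ 2 : ℝ) : ℂ) = ((‖X 0 0‖ ^ 2 - 1 : ℝ) : ℂ) := by
      push_cast
      simp only [RCLike.star_def, Complex.conj_mul', signatureMatrix, Matrix.diagonal_apply_eq,
        Fin.cons_zero] at h0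
      linear_combination h0
    exact_mod_cast this
  set s := ∑ i : Fin n, ‖X i.succ 0‖ ^ 2 with hs
  have hs0 : 0 ≤ s := Finset.sum_nonneg fun i _ => by positivity
  have hn : ‖creationVec fun i : Fin n => X i.succ 0‖ < ‖X 0 0‖ := by
    have h2 : ‖creationVec fun i : Fin n => X i.succ 0‖ ≤ √s := by
      refine ContinuousLinearMap.opNorm_le_bound _ (Real.sqrt_nonneg _) fun ξ => ?_
      rw [← pow_le_pow_iff_left₀ (norm_nonneg _) (by positivity) two_ne_zero, mul_pow,
        Real.sq_sqrt hs0, norm_creationVec_sq]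
    refine h2.trans_lt ?_
    rw [Real.sqrt_lt' (lt_of_le_of_ne (norm_nonneg _) ?_)]
    · linarith
    · intro h
      rw [← h] at h1
      linarith
  have h3 := spectrum.mem_resolventSet_of_norm_lt_mul (𝕜 := ℂ) (k := X 0 0)
    (a := creationVec fun i : Fin n => X i.succ 0) (by
      refine lt_of_le_of_lt ?_ hn
      exact mul_le_of_le_one_right (norm_nonneg _) ContinuousLinearMap.norm_id_le)
  rw [spectrum.mem_resolventSet_iff, Algebra.algebraMap_eq_smul_one] at h3
  exact h3

theorem inner_row {n : ℕ} (q q' : Fin n → Fock n) (c c' : ℂ) :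
    ⟪(∑ j, creation j (q j)) + c • vacuum n, (∑ j, creation j (q' j)) + c' • vacuum n⟫_ℂ
      = (∑ j, ⟪q j, q' j⟫_ℂ) + star c * c' := by
  have hv : ⟪vacuum n, vacuum n⟫_ℂ = 1 := by
    rw [vacuum, inner_basisVec, if_pos rfl]
  simp only [inner_add_left, inner_add_right, sum_inner, inner_sum, inner_smul_left,
    inner_smul_right, inner_creation, inner_vacuum_creation, inner_creation_vacuum, hv]
  simp [mul_comm]

/-- The row `(Φ_X(L_1), …, Φ_X(L_n), (x I - L[z])⁻¹ e_∅)` is isometric. -/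
theorem inner_voiculescu_row {n : ℕ} {X : Matrix (Fin (n + 1)) (Fin (n + 1)) ℂ}
    (hX : IsJUnitary X) (h h' : Fin n → Fock n) (c c' : ℂ) :
    ⟪(∑ i, voiculescuGenerator X i (h i)) + c • voiculescuResolvent X (vacuum n),
      (∑ i, voiculescuGenerator X i (h' i)) + c' • voiculescuResolvent X (vacuum n)⟫_ℂ
      = (∑ i, ⟪h i, h' i⟫_ℂ) + star c * c' := by
  have key : ∀ (h : Fin n → Fock n) (c : ℂ) (g : Fock n),
      g = (∑ i, voiculescuGenerator X i (h i)) + c • voiculescuResolvent X (vacuum n) →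
      ∑ b, X 0 b • (Fin.cons g h : Fin (n + 1) → Fock n) b
        = (∑ j : Fin n, creation j
            (∑ b, X j.succ b • (Fin.cons g h : Fin (n + 1) → Fock n) b)) + c • vacuum n := by
    intro h c g hg
    have h1 : (X 0 0 • (1 : Fock n →L[ℂ] Fock n) - creationVec fun i => X i.succ 0) g
        = (∑ i, (creationVec (fun j => X j.succ i.succ) - X 0 i.succ • 1 :
            Fock n →L[ℂ] Fock n) (h i)) + c • vacuum n := by
      have hinv : ∀ ξ, (X 0 0 • (1 : Fock n →L[ℂ] Fock n) - creationVec fun i => X i.succ 0)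
          (voiculescuResolvent X ξ) = ξ := by
        intro ξ
        have := Ring.mul_inverse_cancel _ (isUnit_voiculescu hX)
        exact congrArg (fun A : Fock n →L[ℂ] Fock n => A ξ) this
      rw [hg, map_add, map_sum, map_smul, hinv]
      congr 1
      refine Finset.sum_congr rfl fun i _ => ?_
      exact hinv _
    simp only [sub_apply, smul_apply,
      one_apply_eq_self, creationVec, sum_apply,
      Finset.sum_sub_distrib] at h1
    simp only [Fin.sum_univ_succ (n := n), Fin.cons_zero, Fin.cons_succ, map_add, map_sum,
      map_smul, Finset.sum_add_distrib]
    rw [Finset.sum_comm (f := fun (x y : Fin n) => X x.succ y.succ • (creation x) (h y))]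
    rw [sub_eq_iff_eq_add] at h1
    rw [h1]
    abel
  set g := (∑ i, voiculescuGenerator X i (h i)) + c • voiculescuResolvent X (vacuum n) with hg
  set g' := (∑ i, voiculescuGenerator X i (h' i)) + c' • voiculescuResolvent X (vacuum n)
    with hg'
  have e := jUnitary_inner hX (Fin.cons g h) (Fin.cons g' h')
  rw [key h c g hg, key h' c' g' hg', inner_row] at e
  simp only [Fin.cons_zero, Fin.cons_succ] at e
  linear_combination e

theorem inner_voiculescuVec {n : ℕ} {X : Matrix (Fin (n + 1)) (Fin (n + 1)) ℂ}
    (hX : IsJUnitary X) (u w : List (Fin n)) :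
    ⟪voiculescuVec X u, voiculescuVec X w⟫_ℂ = if u = w then 1 else 0 := by
  have hnil : voiculescuVec X [] = (∑ i, voiculescuGenerator X i ((0 : Fin n → Fock n) i))
      + (1 : ℂ) • voiculescuResolvent X (vacuum n) := by
    simp [voiculescuVec]
  have hcons : ∀ (i : Fin n) (v : List (Fin n)), voiculescuVec X (i :: v)
      = (∑ j, voiculescuGenerator X j ((Pi.single i (voiculescuVec X v) : Fin n → Fock n) j))
      + (0 : ℂ) • voiculescuResolvent X (vacuum n) := by
    intro i v
    rw [Finset.sum_eq_single i]
    · simp [voiculescuVec]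
    · intro j _ hj
      simp [Pi.single_eq_of_ne hj]
    · simp
  induction u generalizing w with
  | nil =>
    cases w with
    | nil => rw [hnil, inner_voiculescu_row hX]; simp
    | cons j w => rw [hnil, hcons, inner_voiculescu_row hX]; simp
  | cons i u ih =>
    cases w with
    | nil => rw [hnil, hcons, inner_voiculescu_row hX]; simp
    | cons j w =>
      rw [hcons, hcons, inner_voiculescu_row hX]
      rw [Finset.sum_eq_single i]
      · by_cases hij : i = j
        · subst hij; simp [ih]
        · simp [hij]
      · intro k _ hk
        simp [Pi.single_eq_of_ne hk]
      · simp

theorem orthonormal_voiculescuVec {n : ℕ} {X : Matrix (Fin (n + 1)) (Fin (n + 1)) ℂ}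
    (hX : IsJUnitary X) : Orthonormal ℂ (voiculescuVec X) := by
  rw [orthonormal_iff_ite]
  exact inner_voiculescuVec hX

/-- The unitary `U_X`, determined by `U_X e_w = Φ_X(L_w) (x I - L[z])⁻¹ e_∅`. -/
def voiculescuUnitary {n : ℕ} (X : Matrix (Fin (n + 1)) (Fin (n + 1)) ℂ) (hX : IsJUnitary X) :
    Fock n →L[ℂ] Fock n :=
  (isometryOfFamily (voiculescuVec X) (orthonormal_voiculescuVec hX)).toContinuousLinearMap

/-- The Voiculescu automorphism `Φ_X(A) = U_X A U_X*`. -/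
def voiculescuMap {n : ℕ} (X : Matrix (Fin (n + 1)) (Fin (n + 1)) ℂ) (hX : IsJUnitary X)
    (A : Fock n →L[ℂ] Fock n) : Fock n →L[ℂ] Fock n :=
  voiculescuUnitary X hX * A * ContinuousLinearMap.adjoint (voiculescuUnitary X hX)

end FockSpace

end

noncomputable section

namespace FockSpace

open Filter Topology

variable {n : ℕ}

/-! An element `A` of 𝔏_n is determined by `A e_∅`, whose coefficients split it into homogeneous
parts. Letting the letters commute turns the part of degree `k` into a homogeneous polynomial on ℂⁿ,
its symbol. The argument is a dichotomy on the symbols of the elements of `J`.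

The matrices diag(1, ω, …, ω) lie in U(1,n) and act by the gauge automorphisms `L_i ↦ ω L_i`.
Averaging over them shows that the invariant closed ideal `J` contains every homogeneous part of its
elements (`homogeneousPart_mem_of_gaugeMap_mem`). For general `X`, the vector `U_X* e_∅` is a joint
eigenvector of the `L_i*`, so the vacuum expectation of `Φ_X(B)`, with `B` homogeneous, is a nonzero
multiple of the symbol of `B` at `ballPoint X` (`inner_vacuum_voiculescuMap_homogeneousPart`).

If some such value is nonzero, then `Φ_X(B) ∈ J` has a nonzero scalar as its part of degree 0, and
`J` is everything (`eq_top_of_inner_vacuum_ne_zero`). Otherwise all symbols vanish at all ball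
points. These meet every complex line through the origin (`exists_ballPoint_eq_smul`), so by
homogeneity the symbols vanish identically. Reordering letters costs only commutators, hence each
homogeneous part lies in ℭ (`sum_creationWord_mem_commutatorIdeal`), and Cesàro summation puts `A`
itself in ℭ (`mem_of_homogeneousPart_mem`).

Circle integrals are replaced throughout by averages over roots of unity, which are exact on each
fixed matrix entry once the order is large. -/

/-! ### Weak convergence tested on matrix entries -/

theorem inner_basisVec_left (w : List (Fin n)) (ξ : Fock n) : ⟪basisVec w, ξ⟫_ℂ = ξ w := by
  rw [basisVec, lp.inner_single_left]
  simp

theorem ext_inner_basisVec {ξ η : Fock n} (h : ∀ w, ⟪basisVec w, ξ⟫_ℂ = ⟪basisVec w, η⟫_ℂ) :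
    ξ = η := by
  ext w
  simpa [inner_basisVec_left] using h w

theorem dense_span_basisVec :
    Dense (Submodule.span ℂ (Set.range (basisVec (n := n))) : Set (Fock n)) := by
  rw [Submodule.dense_iff_topologicalClosure_eq_top, Submodule.topologicalClosure_eq_top_iff,
    Submodule.eq_bot_iff]
  intro ξ hξ
  refine ext_inner_basisVec fun w => ?_
  rw [inner_zero_right]
  exact (Submodule.mem_orthogonal _ _).1 hξ _ (Submodule.subset_span ⟨w, rfl⟩)

theorem clm_ext_basisVec {E : Type*} [TopologicalSpace E] [T2Space E] [AddCommMonoid E]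
    [Module ℂ E] {S T : Fock n →L[ℂ] E} (h : ∀ w, S (basisVec w) = T (basisVec w)) : S = T :=
  ContinuousLinearMap.ext_on dense_span_basisVec (by rintro _ ⟨w, rfl⟩; exact h w)

/-- A bounded sequence of functionals that converges on the basis vectors converges pointwise. -/
theorem tendsto_apply_of_basisVec {f : ℕ → Fock n →L[ℂ] ℂ} {g : Fock n →L[ℂ] ℂ} {C : ℝ}
    (hC : ∀ m, ‖f m‖ ≤ C)
    (h : ∀ w, Tendsto (fun m => f m (basisVec w)) atTop (𝓝 (g (basisVec w)))) (ξ : Fock n) :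
    Tendsto (fun m => f m ξ) atTop (𝓝 (g ξ)) := by
  have hs : ∀ η ∈ Submodule.span ℂ (Set.range (basisVec (n := n))),
      Tendsto (fun m => f m η) atTop (𝓝 (g η)) := by
    intro η hη
    induction hη using Submodule.span_induction with
    | mem x hx => obtain ⟨w, rfl⟩ := hx; exact h w
    | zero => simp
    | add x y _ _ hx hy => simpa using hx.add hy
    | smul c x _ hx => simpa using hx.const_mul c
  -- The common bound makes the functionals equi-Lipschitz, so convergence passes from the span to
  -- its closure.
  have heq : EquicontinuousAt (fun m => (f m : Fock n → ℂ)) ξ := by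
    refine (LipschitzWith.uniformEquicontinuous _ C.toNNReal fun m => ?_).equicontinuous ξ
    refine (f m).lipschitz.weaken ?_
    rw [← NNReal.coe_le_coe]
    exact (hC m).trans (Real.le_coe_toNNReal C)
  exact heq.tendsto_of_mem_closure (g.continuous.continuousAt.mono_left inf_le_left) hs
    (dense_span_basisVec ξ)

/-- A bounded sequence of operators whose matrix entries converge is weakly convergent. -/
theorem tendsto_inner_of_entries {T : ℕ → Fock n →L[ℂ] Fock n} {S : Fock n →L[ℂ] Fock n} {C : ℝ}
    (hC : ∀ m, ‖T m‖ ≤ C)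
    (h : ∀ v w, Tendsto (fun m => ⟪basisVec v, T m (basisVec w)⟫_ℂ) atTop
      (𝓝 ⟪basisVec v, S (basisVec w)⟫_ℂ)) (ξ η : Fock n) :
    Tendsto (fun m => ⟪η, T m ξ⟫_ℂ) atTop (𝓝 ⟪η, S ξ⟫_ℂ) := by
  have hC0 : 0 ≤ C := (norm_nonneg _).trans (hC 0)
  have h1 : ∀ w ζ, Tendsto (fun m => ⟪ζ, T m (basisVec w)⟫_ℂ) atTop
      (𝓝 ⟪ζ, S (basisVec w)⟫_ℂ) := by
    intro w ζ
    -- The inner product is conjugate linear in its left slot; conjugating makes the dependence on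
    -- `ζ` a bounded linear functional, so the previous lemma applies in this slot too.
    have h2 := tendsto_apply_of_basisVec (f := fun m => innerSL ℂ (T m (basisVec w)))
      (g := innerSL ℂ (S (basisVec w))) (C := C * ‖basisVec (n := n) w‖)
      (fun m => by
        rw [innerSL_apply_norm]
        exact (T m).le_of_opNorm_le (hC m) _)
      (fun v => by
        have h3 := (Complex.continuous_conj.tendsto _).comp (h v w)
        rw [inner_conj_symm] at h3
        exact h3.congr fun m => inner_conj_symm _ _) ζ
    have h3 := (Complex.continuous_conj.tendsto _).comp h2
    rw [innerSL_apply_apply, inner_conj_symm] at h3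
    exact h3.congr fun m => inner_conj_symm _ _
  exact tendsto_apply_of_basisVec (f := fun m => innerSL ℂ η ∘L T m) (g := innerSL ℂ η ∘L S)
    (C := ‖η‖ * C)
    (fun m => (ContinuousLinearMap.opNorm_comp_le _ _).trans (by
      rw [innerSL_apply_norm]
      exact mul_le_mul_of_nonneg_left (hC m) (norm_nonneg _)))
    (fun w => h1 w η) ξ

/-- All weak limits below are taken through this criterion: for bounded sequences, convergence of
matrix entries is already WOT convergence. -/
theorem IsWOTClosed.mem_of_tendsto_entries {S : Set (Fock n →L[ℂ] Fock n)} (hS : IsWOTClosed S)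
    {T : ℕ → Fock n →L[ℂ] Fock n} {A : Fock n →L[ℂ] Fock n} {C : ℝ}
    (hC : ∀ m, ‖T m‖ ≤ C) (hT : ∀ m, T m ∈ S)
    (h : ∀ v w, Tendsto (fun m => ⟪basisVec v, T m (basisVec w)⟫_ℂ) atTop
      (𝓝 ⟪basisVec v, A (basisVec w)⟫_ℂ)) : A ∈ S := by
  have : Tendsto (fun m => ContinuousLinearMapWOT.ofCLM (T m)) atTop
      (𝓝 (ContinuousLinearMapWOT.ofCLM A)) := by
    rw [ContinuousLinearMapWOT.tendsto_iff_forall_inner_apply_tendsto]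
    exact fun ξ η => tendsto_inner_of_entries hC h ξ η
  exact hS.mem_of_tendsto this (Eventually.of_forall hT)

/-- The norm is lower semicontinuous for weak limits: bound the limit of `⟪A ξ, T m ξ⟫` and cancel
one factor `‖A ξ‖`. -/
theorem norm_le_of_tendsto_entries {T : ℕ → Fock n →L[ℂ] Fock n} {A : Fock n →L[ℂ] Fock n}
    {C : ℝ} (hC : ∀ m, ‖T m‖ ≤ C)
    (h : ∀ v w, Tendsto (fun m => ⟪basisVec v, T m (basisVec w)⟫_ℂ) atTop
      (𝓝 ⟪basisVec v, A (basisVec w)⟫_ℂ)) : ‖A‖ ≤ C := by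
  have hC0 : 0 ≤ C := (norm_nonneg _).trans (hC 0)
  refine A.opNorm_le_bound hC0 fun ξ => ?_
  have h1 := (tendsto_inner_of_entries hC h ξ (A ξ)).norm
  have h2 : ‖⟪A ξ, A ξ⟫_ℂ‖ ≤ ‖A ξ‖ * (C * ‖ξ‖) :=
    le_of_tendsto h1 (Eventually.of_forall fun m => (norm_inner_le_norm _ _).trans
      (mul_le_mul_of_nonneg_left ((T m).le_of_opNorm_le (hC m) ξ) (norm_nonneg _)))
  rw [← inner_self_re_eq_norm, inner_self_eq_norm_mul_norm] at h2
  rcases (norm_nonneg (A ξ)).eq_or_lt with h0 | h0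
  · rw [← h0]; positivity
  · exact le_of_mul_le_mul_left h2 h0

theorem isWOTClosed_setOf_inner_eq (ξ η ξ' η' : Fock n) (c c' : ℂ) :
    IsWOTClosed {A : Fock n →L[ℂ] Fock n | c * ⟪η, A ξ⟫_ℂ = c' * ⟪η', A ξ'⟫_ℂ} := by
  have hc : ∀ ξ η : Fock n, Continuous fun A : Fock n →WOT[ℂ] Fock n => ⟪η, A ξ⟫_ℂ :=
    fun ξ η => ContinuousLinearMapWOT.continuous_iff.1 continuous_id ξ η
  exact isClosed_eq ((hc ξ η).const_mul c) ((hc ξ' η').const_mul c')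

theorem IsWOTClosed.iInter {ι : Sort*} {S : ι → Set (Fock n →L[ℂ] Fock n)}
    (h : ∀ i, IsWOTClosed (S i)) : IsWOTClosed (⋂ i, S i) := by
  unfold IsWOTClosed
  rw [Set.preimage_iInter]
  exact isClosed_iInter h

/-! ### The Toeplitz algebra -/

theorem creation_basisVec (i : Fin n) (w : List (Fin n)) :
    creation i (basisVec w) = basisVec (i :: w) :=
  isometryOfFamily_basisVec _ (orthonormal_cons i) _

theorem creation_mem (i : Fin n) : creation i ∈ toeplitzAlgebra n := by
  rw [toeplitzAlgebra, Algebra.mem_sInf]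
  exact fun A hA => hA.2 i

theorem isWOTClosed_toeplitzAlgebra :
    IsWOTClosed (toeplitzAlgebra n : Set (Fock n →L[ℂ] Fock n)) := by
  rw [toeplitzAlgebra, Algebra.coe_sInf]
  simp only [Set.biInter_eq_iInter]
  exact IsWOTClosed.iInter fun A => A.2.1

theorem toeplitzAlgebra_le {B : Subalgebra ℂ (Fock n →L[ℂ] Fock n)}
    (hB : IsWOTClosed (B : Set (Fock n →L[ℂ] Fock n))) (h : ∀ i, creation i ∈ B) :
    toeplitzAlgebra n ≤ B :=
  sInf_le ⟨hB, h⟩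

theorem orthonormal_append (w : List (Fin n)) :
    Orthonormal ℂ (fun u : List (Fin n) => basisVec (u ++ w)) := by
  rw [orthonormal_iff_ite]
  intro u v
  simp [inner_basisVec]

/-- The right creation operator `e_u ↦ e_{uw}`. -/
def rightCreation (w : List (Fin n)) : Fock n →L[ℂ] Fock n :=
  (isometryOfFamily (fun u => basisVec (u ++ w)) (orthonormal_append w)).toContinuousLinearMap

theorem rightCreation_basisVec (w u : List (Fin n)) :
    rightCreation w (basisVec u) = basisVec (u ++ w) :=
  isometryOfFamily_basisVec _ (orthonormal_append w) _

theorem inner_basisVec_rightCreation (w u : List (Fin n)) (ξ : Fock n) :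
    ⟪basisVec (u ++ w), rightCreation w ξ⟫_ℂ = ⟪basisVec u, ξ⟫_ℂ := by
  rw [← rightCreation_basisVec]
  exact (isometryOfFamily (fun u => basisVec (u ++ w)) (orthonormal_append w)).inner_map_map _ _

theorem inner_basisVec_rightCreation_eq_zero {w v : List (Fin n)} (h : ∀ u, v ≠ u ++ w)
    (ξ : Fock n) : ⟪basisVec v, rightCreation w ξ⟫_ℂ = 0 := by
  refine inner_isometryOfFamily_eq_zero _ (orthonormal_append w) _ _ fun u => ?_
  rw [inner_basisVec, if_neg (h u)]

/-- Left and right creation commute on words, and the centralizer of `rightCreation w` is cut out by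
equations between matrix coefficients, hence WOT closed. Minimality of 𝔏_n does the rest. -/
theorem rightCreation_comm {A : Fock n →L[ℂ] Fock n} (hA : A ∈ toeplitzAlgebra n)
    (w : List (Fin n)) : A * rightCreation w = rightCreation w * A := by
  have h : toeplitzAlgebra n ≤ Subalgebra.centralizer ℂ {rightCreation w} := by
    refine toeplitzAlgebra_le ?_ fun i => ?_
    · have : ((Subalgebra.centralizer ℂ {rightCreation w} :
          Subalgebra ℂ (Fock n →L[ℂ] Fock n)) : Set (Fock n →L[ℂ] Fock n))
          = ⋂ (ξ : Fock n) (η : Fock n), {A : Fock n →L[ℂ] Fock n |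
            1 * ⟪ContinuousLinearMap.adjoint (rightCreation w) η, A ξ⟫_ℂ
              = 1 * ⟪η, A (rightCreation w ξ)⟫_ℂ} := by
        ext A
        simp only [SetLike.mem_coe, Subalgebra.mem_centralizer_iff, Set.mem_singleton_iff,
          forall_eq, Set.mem_iInter, Set.mem_ofPred_eq, one_mul,
          ContinuousLinearMap.adjoint_inner_left]
        constructor
        · intro h ξ η
          exact congrArg (fun B : Fock n →L[ℂ] Fock n => ⟪η, B ξ⟫_ℂ) h
        · intro h
          ext1 ξ
          exact ext_inner_left ℂ fun η => h ξ η
      rw [this]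
      exact IsWOTClosed.iInter fun ξ => IsWOTClosed.iInter fun η =>
        isWOTClosed_setOf_inner_eq _ _ _ _ _ _
    · rw [Subalgebra.mem_centralizer_iff]
      rintro _ rfl
      refine clm_ext_basisVec fun u => ?_
      simp [creation_basisVec, rightCreation_basisVec]
  exact ((Subalgebra.mem_centralizer_iff ℂ).1 (h hA) _ rfl).symm

/-- Since `e_w` is the right translate of the vacuum, commutation with right creation lets `A e_∅`
determine `A`. -/
theorem toeplitz_apply_basisVec {A : Fock n →L[ℂ] Fock n} (hA : A ∈ toeplitzAlgebra n)
    (w : List (Fin n)) : A (basisVec w) = rightCreation w (A (vacuum n)) := by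
  have h := congrArg (fun B : Fock n →L[ℂ] Fock n => B (vacuum n)) (rightCreation_comm hA w)
  simpa [vacuum, rightCreation_basisVec] using h

/-- The operator `L_w`. -/
def creationWord (w : List (Fin n)) : Fock n →L[ℂ] Fock n := (w.map creation).prod

theorem creationWord_basisVec (u w : List (Fin n)) :
    creationWord u (basisVec w) = basisVec (u ++ w) := by
  induction u with
  | nil => simp [creationWord]
  | cons i u ih =>
    have : creationWord (i :: u) = creation i * creationWord u := by simp [creationWord]
    rw [this, mul_apply_eq_comp, ih, creation_basisVec, List.cons_append]

theorem creationWord_mem (w : List (Fin n)) : creationWord w ∈ toeplitzAlgebra n := by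
  refine Subalgebra.list_prod_mem _ fun A hA => ?_
  obtain ⟨i, _, rfl⟩ := List.mem_map.1 hA
  exact creation_mem i

/-! ### Homogeneous components -/

variable (n) in
/-- The words of length `k`. -/
def words (k : ℕ) : Finset (List (Fin n)) :=
  Finset.univ.image (fun f : Fin k → Fin n => List.ofFn f)

theorem mem_words {k : ℕ} {w : List (Fin n)} : w ∈ words n k ↔ w.length = k := by
  simp only [words, Finset.mem_image, Finset.mem_univ, true_and]
  constructor
  · rintro ⟨f, rfl⟩; simp
  · rintro rfl; exact ⟨w.get, List.ofFn_get w⟩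

/-- The homogeneous component of degree `k` of an element of the Toeplitz algebra. -/
def homogeneousPart (A : Fock n →L[ℂ] Fock n) (k : ℕ) : Fock n →L[ℂ] Fock n :=
  ∑ u ∈ words n k, ⟪basisVec u, A (vacuum n)⟫_ℂ • creationWord u

theorem inner_basisVec_toeplitz_eq_zero {A : Fock n →L[ℂ] Fock n} (hA : A ∈ toeplitzAlgebra n)
    {v w : List (Fin n)} (h : v.length < w.length) : ⟪basisVec v, A (basisVec w)⟫_ℂ = 0 := by
  rw [toeplitz_apply_basisVec hA]
  refine inner_basisVec_rightCreation_eq_zero (fun u hu => ?_) _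
  rw [hu, List.length_append] at h
  omega

/-- Passing to degree `k` keeps exactly the matrix entries that raise word length by `k`. This is
the form in which Fourier averages are recognized. -/
theorem inner_homogeneousPart {A : Fock n →L[ℂ] Fock n} (hA : A ∈ toeplitzAlgebra n) (k : ℕ)
    (v w : List (Fin n)) :
    ⟪basisVec v, homogeneousPart A k (basisVec w)⟫_ℂ
      = if v.length = k + w.length then ⟪basisVec v, A (basisVec w)⟫_ℂ else 0 := by
  have h1 : ⟪basisVec v, homogeneousPart A k (basisVec w)⟫_ℂ
      = ∑ u ∈ words n k, if v = u ++ w then ⟪basisVec u, A (vacuum n)⟫_ℂ else 0 := by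
    simp only [homogeneousPart, sum_apply, smul_apply, inner_sum, inner_smul_right,
      creationWord_basisVec, inner_basisVec, mul_ite, mul_one, mul_zero]
  rw [h1, toeplitz_apply_basisVec hA]
  by_cases hv : ∃ u, v = u ++ w
  · obtain ⟨u, rfl⟩ := hv
    simp only [List.append_cancel_right_eq, Finset.sum_ite_eq, mem_words, List.length_append,
      add_left_inj, inner_basisVec_rightCreation]
  · push Not at hv
    rw [inner_basisVec_rightCreation_eq_zero hv, ite_self]
    exact Finset.sum_eq_zero fun u _ => if_neg (hv u)

/-! ### Ideals of the Toeplitz algebra -/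

theorem mem_idealOperators_iff {J : TwoSidedIdeal (toeplitzAlgebra n)} {A : Fock n →L[ℂ] Fock n} :
    A ∈ idealOperators J ↔ ∃ hA : A ∈ toeplitzAlgebra n, (⟨A, hA⟩ : toeplitzAlgebra n) ∈ J := by
  constructor
  · rintro ⟨a, ha, rfl⟩
    exact ⟨a.2, ha⟩
  · rintro ⟨hA, h⟩
    exact ⟨_, h, rfl⟩

theorem coe_mem_idealOperators {J : TwoSidedIdeal (toeplitzAlgebra n)} {a : toeplitzAlgebra n} :
    (a : Fock n →L[ℂ] Fock n) ∈ idealOperators J ↔ a ∈ J :=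
  mem_idealOperators_iff.trans ⟨fun h => h.2, fun h => ⟨a.2, h⟩⟩

/-- The operators of a two-sided ideal, as a linear subspace. -/
def idealSubmodule (J : TwoSidedIdeal (toeplitzAlgebra n)) : Submodule ℂ (Fock n →L[ℂ] Fock n) where
  carrier := idealOperators J
  add_mem' := by
    rintro _ _ ⟨a, ha, rfl⟩ ⟨b, hb, rfl⟩
    exact ⟨a + b, J.add_mem ha hb, rfl⟩
  zero_mem' := ⟨0, J.zero_mem, rfl⟩
  smul_mem' := by
    rintro c _ ⟨a, ha, rfl⟩
    refine ⟨algebraMap ℂ _ c * a, J.mul_mem_left _ _ ha, ?_⟩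
    rw [← Algebra.smul_def]
    rfl

/-- Intersecting with 𝔏_n itself, which is closed, also covers an empty family of ideals. -/
theorem isWOTClosed_idealOperators_sInf {S : Set (TwoSidedIdeal (toeplitzAlgebra n))}
    (hS : ∀ J ∈ S, IsWOTClosed (idealOperators J)) : IsWOTClosed (idealOperators (sInf S)) := by
  have : idealOperators (sInf S) = (toeplitzAlgebra n : Set (Fock n →L[ℂ] Fock n))
      ∩ ⋂ J : S, idealOperators J.1 := by
    ext A
    simp only [mem_idealOperators_iff, TwoSidedIdeal.mem_sInf, Set.mem_inter_iff, SetLike.mem_coe,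
      Set.mem_iInter, Subtype.forall]
    constructor
    · rintro ⟨hA, h⟩
      exact ⟨hA, fun J hJ => ⟨hA, h J hJ⟩⟩
    · rintro ⟨hA, h⟩
      exact ⟨hA, fun J hJ => (h J hJ).2⟩
  rw [this]
  exact IsClosed.inter isWOTClosed_toeplitzAlgebra (IsWOTClosed.iInter fun J => hS J.1 J.2)

theorem isWOTClosed_commutatorIdeal : IsWOTClosed (idealOperators (commutatorIdeal n)) :=
  isWOTClosed_idealOperators_sInf fun _ hJ => hJ.1

theorem commutator_mem (A B : toeplitzAlgebra n) : A * B - B * A ∈ commutatorIdeal n := by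
  rw [commutatorIdeal, TwoSidedIdeal.mem_sInf]
  exact fun J hJ => hJ.2 A B

/-- `L_w` as an element of the Toeplitz algebra. -/
def toeplitzWord (w : List (Fin n)) : toeplitzAlgebra n := ⟨creationWord w, creationWord_mem w⟩

theorem toeplitzWord_append (u v : List (Fin n)) :
    toeplitzWord (u ++ v) = toeplitzWord u * toeplitzWord v :=
  Subtype.ext (by simp [toeplitzWord, creationWord])

/-- Permutations are generated by adjacent swaps, and a swap changes the word operator by a
commutator times a word operator. -/
theorem toeplitzWord_sub_mem_of_perm {u v : List (Fin n)} (h : u.Perm v) :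
    toeplitzWord u - toeplitzWord v ∈ commutatorIdeal n := by
  induction h with
  | nil => simp [(commutatorIdeal n).zero_mem]
  | @cons i u v _ ih =>
    change toeplitzWord ([i] ++ u) - toeplitzWord ([i] ++ v) ∈ _
    rw [toeplitzWord_append, toeplitzWord_append, ← mul_sub]
    exact (commutatorIdeal n).mul_mem_left _ _ ih
  | swap i j l =>
    have h : ∀ i j : Fin n, toeplitzWord (i :: j :: l)
        = toeplitzWord [i] * toeplitzWord [j] * toeplitzWord l := by
      intro i j
      rw [← toeplitzWord_append, ← toeplitzWord_append]
      rfl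
    rw [h, h, ← sub_mul]
    exact (commutatorIdeal n).mul_mem_right _ _ (commutator_mem _ _)
  | trans _ _ h1 h2 =>
    have := (commutatorIdeal n).add_mem h1 h2
    rwa [sub_add_sub_cancel] at this

/-- A polynomial in the creation operators whose commutative symbol vanishes lies in the
commutator ideal. -/
theorem sum_creationWord_mem_commutatorIdeal (s : Finset (List (Fin n))) (a : List (Fin n) → ℂ)
    (h : ∀ μ : Fin n → ℂ, ∑ u ∈ s, a u * (u.map μ).prod = 0) :
    ∑ u ∈ s, a u • creationWord u ∈ idealOperators (commutatorIdeal n) := by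
  set e : List (Fin n) → (Fin n →₀ ℕ) := fun u => Multiset.toFinsupp (u : Multiset (Fin n))
  have hmon : ∀ u : List (Fin n),
      (MvPolynomial.monomial (e u) 1 : MvPolynomial (Fin n) ℂ) = (u.map MvPolynomial.X).prod := by
    intro u
    induction u with
    | nil => simp [e]
    | cons i u ih =>
      rw [List.map_cons, List.prod_cons, ← ih, MvPolynomial.X, MvPolynomial.monomial_mul, one_mul]
      congr 1
      simp only [e]
      rw [← Multiset.cons_coe, ← Multiset.singleton_add, Multiset.toFinsupp_add,
        Multiset.toFinsupp_singleton]
  -- The abelianized polynomial vanishes at every point of ℂⁿ, so it is zero as a formal polynomial.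
  have hP : ∑ u ∈ s, a u • (MvPolynomial.monomial (e u) 1 : MvPolynomial (Fin n) ℂ) = 0 := by
    refine MvPolynomial.funext fun μ => ?_
    rw [map_zero, ← h μ, map_sum]
    refine Finset.sum_congr rfl fun u _ => ?_
    rw [MvPolynomial.smul_eval, hmon, map_list_prod, List.map_map]
    congr 3
    funext i
    simp
  -- A linear section of abelianization: each monomial is sent to the word operator of one chosen
  -- ordering of its letters.
  set Λ : MvPolynomial (Fin n) ℂ →ₗ[ℂ] (Fock n →L[ℂ] Fock n) :=
    (MvPolynomial.basisMonomials (Fin n) ℂ).constr ℂ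
      (fun m => creationWord (Finsupp.toMultiset m).toList)
  have hΛ : ∀ u, Λ (MvPolynomial.monomial (e u) 1)
      = creationWord (u : Multiset (Fin n)).toList := by
    intro u
    have := (MvPolynomial.basisMonomials (Fin n) ℂ).constr_basis ℂ
      (fun m => creationWord (Finsupp.toMultiset m).toList) (e u)
    rw [MvPolynomial.coe_basisMonomials] at this
    rw [this]
    simp [e]
  have h0 : ∑ u ∈ s, a u • creationWord (u : Multiset (Fin n)).toList = 0 := by
    rw [← map_zero Λ, ← hP, map_sum]
    simp only [map_smul, hΛ]
  -- Subtracting the zero image under `Λ` leaves a combination of differences between words and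
  -- their rearrangements.
  rw [← sub_zero (∑ u ∈ s, a u • creationWord u), ← h0, ← Finset.sum_sub_distrib]
  simp only [← smul_sub]
  refine (idealSubmodule (commutatorIdeal n)).sum_mem fun u _ => Submodule.smul_mem _ _ ?_
  have hp : u.Perm (u : Multiset (Fin n)).toList := by
    rw [← Multiset.coe_eq_coe, Multiset.coe_toList]
  exact ⟨_, toeplitzWord_sub_mem_of_perm hp, rfl⟩

/-! ### The gauge action -/

theorem voiculescuUnitary_basisVec {X : Matrix (Fin (n + 1)) (Fin (n + 1)) ℂ} (hX : IsJUnitary X)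
    (w : List (Fin n)) : voiculescuUnitary X hX (basisVec w) = voiculescuVec X w :=
  isometryOfFamily_basisVec _ (orthonormal_voiculescuVec hX) _

theorem inner_voiculescuMap {X : Matrix (Fin (n + 1)) (Fin (n + 1)) ℂ} (hX : IsJUnitary X)
    (A : Fock n →L[ℂ] Fock n) (ξ η : Fock n) :
    ⟪η, voiculescuMap X hX A ξ⟫_ℂ = ⟪ContinuousLinearMap.adjoint (voiculescuUnitary X hX) η,
      A (ContinuousLinearMap.adjoint (voiculescuUnitary X hX) ξ)⟫_ℂ := by
  rw [ContinuousLinearMap.adjoint_inner_left]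
  rfl

theorem norm_voiculescuMap_le {X : Matrix (Fin (n + 1)) (Fin (n + 1)) ℂ} (hX : IsJUnitary X)
    (A : Fock n →L[ℂ] Fock n) : ‖voiculescuMap X hX A‖ ≤ ‖A‖ := by
  have hU : ‖voiculescuUnitary X hX‖ ≤ 1 :=
    LinearIsometry.norm_toContinuousLinearMap_le _
  have hU' : ‖ContinuousLinearMap.adjoint (voiculescuUnitary X hX)‖ ≤ 1 :=
    (LinearIsometryEquiv.norm_map _ _).trans_le hU
  calc ‖voiculescuMap X hX A‖
      ≤ ‖voiculescuUnitary X hX‖ * ‖A‖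
        * ‖ContinuousLinearMap.adjoint (voiculescuUnitary X hX)‖ := norm_mul₃_le
    _ ≤ 1 * ‖A‖ * 1 := by gcongr
    _ = ‖A‖ := by ring

variable (n) in
/-- The matrix `diag(1, ω, …, ω)`. -/
def gaugeMatrix (ω : Circle) : Matrix (Fin (n + 1)) (Fin (n + 1)) ℂ :=
  Matrix.diagonal (Fin.cons 1 fun _ => (ω : ℂ))

theorem isJUnitary_gaugeMatrix (ω : Circle) : IsJUnitary (gaugeMatrix n ω) := by
  rw [IsJUnitary, gaugeMatrix, signatureMatrix, Matrix.diagonal_conjTranspose,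
    Matrix.diagonal_mul_diagonal, Matrix.diagonal_mul_diagonal]
  congr 1
  funext i
  refine Fin.cases ?_ (fun i => ?_) i
  · simp
  · simp only [Pi.star_apply, Fin.cons_succ, mul_one, RCLike.star_def, Complex.conj_mul',
      Circle.norm_coe]
    simp

/-- The gauge automorphism `L_i ↦ ω L_i`. -/
def gaugeMap (ω : Circle) (A : Fock n →L[ℂ] Fock n) : Fock n →L[ℂ] Fock n :=
  voiculescuMap (gaugeMatrix n ω) (isJUnitary_gaugeMatrix ω) A

theorem voiculescuVec_gaugeMatrix (ω : Circle) (w : List (Fin n)) :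
    voiculescuVec (gaugeMatrix n ω) w = (ω : ℂ) ^ w.length • basisVec w := by
  have hr : voiculescuResolvent (gaugeMatrix n ω) = 1 := by
    simp [voiculescuResolvent, gaugeMatrix, creationVec]
  have hg : ∀ i, voiculescuGenerator (gaugeMatrix n ω) i = (ω : ℂ) • creation i := by
    intro i
    rw [voiculescuGenerator, hr, one_mul]
    simp [gaugeMatrix, creationVec, Matrix.diagonal_apply, ite_smul, (Fin.succ_ne_zero i).symm]
  induction w with
  | nil => simp [voiculescuVec, hr, vacuum]
  | cons i w ih =>
    have : voiculescuVec (gaugeMatrix n ω) (i :: w)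
        = voiculescuGenerator (gaugeMatrix n ω) i (voiculescuVec (gaugeMatrix n ω) w) := by
      simp [voiculescuVec]
    rw [this, ih, hg, map_smul, smul_apply, creation_basisVec, smul_smul, List.length_cons,
      pow_succ]

/-- The gauge unitary is diagonal in the word basis with eigenvalue `ω ^ length`, so entries are
graded by the change in length. The exponent is an integer because this change may be negative. -/
theorem inner_gaugeMap (ω : Circle) (A : Fock n →L[ℂ] Fock n) (v w : List (Fin n)) :
    ⟪basisVec v, gaugeMap ω A (basisVec w)⟫_ℂ
      = (ω : ℂ) ^ ((v.length : ℤ) - w.length) * ⟪basisVec v, A (basisVec w)⟫_ℂ := by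
  have hadj : ∀ w : List (Fin n), ContinuousLinearMap.adjoint
      (voiculescuUnitary (gaugeMatrix n ω) (isJUnitary_gaugeMatrix ω)) (basisVec w)
      = (starRingEnd ℂ (ω : ℂ)) ^ w.length • basisVec w := by
    intro w
    refine ext_inner_basisVec fun v => ?_
    rw [ContinuousLinearMap.adjoint_inner_right, voiculescuUnitary_basisVec,
      voiculescuVec_gaugeMatrix, inner_smul_left, inner_smul_right, inner_basisVec]
    split_ifs with h
    · rw [h, map_pow]
    · simp
  rw [gaugeMap, inner_voiculescuMap, hadj, hadj, map_smul, inner_smul_left, inner_smul_right,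
    map_pow, Complex.conj_conj, ← Circle.coe_inv_eq_conj, zpow_sub₀ (Circle.coe_ne_zero ω),
    zpow_natCast, zpow_natCast, Circle.coe_inv, inv_pow, div_eq_mul_inv, mul_assoc]

/-- The root of unity `exp (2πi/m)` on the circle. -/
def rootOfUnity (m : ℕ) : Circle := Circle.exp (2 * Real.pi / m)

theorem sum_rootOfUnity_zpow {m : ℕ} (hm : m ≠ 0) (l : ℤ) :
    ∑ j ∈ Finset.range m, ((rootOfUnity m ^ j : Circle) : ℂ) ^ l
      = if (m : ℤ) ∣ l then (m : ℂ) else 0 := by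
  have hζ : IsPrimitiveRoot (rootOfUnity m : ℂ) m := by
    convert! Complex.isPrimitiveRoot_exp m hm using 1
    rw [rootOfUnity, Circle.coe_exp]
    push_cast
    congr 1
    ring
  have h1 : ∀ j : ℕ, ((rootOfUnity m ^ j : Circle) : ℂ) ^ l = ((rootOfUnity m : ℂ) ^ l) ^ j := by
    intro j
    rw [Circle.coe_pow, ← zpow_natCast, ← zpow_natCast, zpow_comm]
  simp only [h1]
  split_ifs with h
  · rw [(hζ.zpow_eq_one_iff_dvd l).2 h]
    simp
  · have h2 := mul_neg_geom_sum ((rootOfUnity m : ℂ) ^ l) m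
    rw [← zpow_natCast, zpow_comm, zpow_natCast, hζ.pow_eq_one, one_zpow, sub_self] at h2
    exact (mul_eq_zero.1 h2).resolve_left fun h3 =>
      h ((hζ.zpow_eq_one_iff_dvd l).1 (sub_eq_zero.1 h3).symm)

/-- The weighted average `∑ c_j Φ_{ζ^j}(A)` over the `m`-th roots of unity. -/
def gaugeSum (m : ℕ) (c : ℕ → ℂ) (A : Fock n →L[ℂ] Fock n) : Fock n →L[ℂ] Fock n :=
  ∑ j ∈ Finset.range m, c j • gaugeMap (rootOfUnity m ^ j) A

theorem norm_gaugeSum_le (m : ℕ) (c : ℕ → ℂ) (A : Fock n →L[ℂ] Fock n) :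
    ‖gaugeSum m c A‖ ≤ (∑ j ∈ Finset.range m, ‖c j‖) * ‖A‖ := by
  rw [Finset.sum_mul]
  refine norm_sum_le_of_le _ fun j _ => ?_
  rw [norm_smul]
  exact mul_le_mul_of_nonneg_left (norm_voiculescuMap_le _ _) (norm_nonneg _)

theorem inner_gaugeSum (m : ℕ) (c : ℕ → ℂ) (A : Fock n →L[ℂ] Fock n) (v w : List (Fin n)) :
    ⟪basisVec v, gaugeSum m c A (basisVec w)⟫_ℂ
      = (∑ j ∈ Finset.range m,
          c j * ((rootOfUnity m ^ j : Circle) : ℂ) ^ ((v.length : ℤ) - w.length))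
        * ⟪basisVec v, A (basisVec w)⟫_ℂ := by
  simp only [gaugeSum, sum_apply, smul_apply, inner_sum, inner_smul_right,
    inner_gaugeMap, Finset.sum_mul, mul_assoc]

theorem sum_rootOfUnity_zpow_of_lt {m : ℕ} {l : ℤ} (h : |l| < m) :
    ∑ j ∈ Finset.range m, ((rootOfUnity m ^ j : Circle) : ℂ) ^ l
      = if l = 0 then (m : ℂ) else 0 := by
  have hm : m ≠ 0 := by
    have := abs_nonneg l
    omega
  rw [sum_rootOfUnity_zpow hm]
  exact if_congr ⟨fun hd => Int.eq_zero_of_abs_lt_dvd hd h, fun h => h ▸ dvd_zero _⟩ rfl rfl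

/-- The part of degree `k` is the `k`-th Fourier coefficient of `ω ↦ gaugeMap ω A`. Discrete Fourier
averages lie in `S`, have norm at most `‖A‖`, and converge entrywise to it. -/
theorem homogeneousPart_mem_of_gaugeMap_mem {S : Submodule ℂ (Fock n →L[ℂ] Fock n)}
    (hS : IsWOTClosed (S : Set (Fock n →L[ℂ] Fock n))) {A : Fock n →L[ℂ] Fock n}
    (hA : A ∈ toeplitzAlgebra n) (h : ∀ ω, gaugeMap ω A ∈ S) (k : ℕ) :
    homogeneousPart A k ∈ S := by
  refine hS.mem_of_tendsto_entries (C := ‖A‖)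
    (T := fun m => gaugeSum (m + 1)
      (fun j => (m + 1 : ℂ)⁻¹ * ((rootOfUnity (m + 1) ^ j : Circle) : ℂ) ^ (-(k : ℤ))) A)
    (fun m => ?_) (fun m => S.sum_mem fun j _ => S.smul_mem _ (h _)) fun v w => ?_
  · refine (norm_gaugeSum_le _ _ _).trans (le_of_eq ?_)
    have : ‖(m + 1 : ℂ)‖ = m + 1 := by exact_mod_cast Complex.norm_natCast (m + 1)
    simp only [norm_mul, norm_inv, norm_zpow, Circle.norm_coe, one_zpow, mul_one,
      Finset.sum_const, Finset.card_range, nsmul_eq_mul, this]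
    push_cast
    field_simp
  · refine tendsto_const_nhds.congr' ?_
    -- From here on the relevant exponent is smaller in absolute value than the order `m + 1`, so
    -- there is no aliasing and the entry is exact.
    filter_upwards [eventually_ge_atTop (k + v.length + w.length)] with m hm
    rw [inner_gaugeSum, inner_homogeneousPart hA]
    simp only [mul_assoc, ← Finset.mul_sum, ← zpow_add₀ (Circle.coe_ne_zero _)]
    rw [sum_rootOfUnity_zpow_of_lt]
    · have : (-(k : ℤ) + (v.length - w.length) = 0) ↔ v.length = k + w.length := by omega
      simp only [this]
      split_ifs
      · push_cast
        rw [inv_mul_cancel_left₀ (by exact_mod_cast Nat.succ_ne_zero m)]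
      · simp
    · rw [abs_lt]
      push_cast
      omega

/-! ### Cesàro means -/

/-- The Cesàro means of the homogeneous expansion. -/
def cesaroMean (A : Fock n →L[ℂ] Fock n) (N : ℕ) : Fock n →L[ℂ] Fock n :=
  ∑ k ∈ Finset.range N, (((N - k : ℕ) : ℂ) / N) • homogeneousPart A k

theorem inner_cesaroMean {A : Fock n →L[ℂ] Fock n} (hA : A ∈ toeplitzAlgebra n) (N : ℕ)
    (v w : List (Fin n)) :
    ⟪basisVec v, cesaroMean A N (basisVec w)⟫_ℂ
      = (((N - (v.length - w.length) : ℕ) : ℂ) / N) * ⟪basisVec v, A (basisVec w)⟫_ℂ := by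
  simp only [cesaroMean, sum_apply, smul_apply, inner_sum, inner_smul_right,
    inner_homogeneousPart hA]
  -- The weight uses truncated subtraction of lengths; where it truncates, the entry of `A` is zero.
  rcases lt_or_ge v.length w.length with h | h
  · simp [inner_basisVec_toeplitz_eq_zero hA h]
  · obtain ⟨k, hk⟩ := Nat.exists_eq_add_of_le' h
    rw [hk, Nat.add_sub_cancel]
    simp only [add_left_inj, mul_ite, mul_zero, Finset.sum_ite_eq, Finset.mem_range]
    split_ifs with hkN
    · rfl
    · rw [Nat.sub_eq_zero_of_le (not_lt.1 hkN)]
      simp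

/-- The Fejér weights on the `m`-th roots of unity. -/
def fejerWeight (m N j : ℕ) : ℂ :=
  (m * N : ℂ)⁻¹ * ∑ a ∈ Finset.range N, ∑ b ∈ Finset.range N,
    ((rootOfUnity m ^ j : Circle) : ℂ) ^ ((a : ℤ) - b)

/-- Orthogonality of characters on the `m`-th roots of unity. Since `|a - b| < N`, the bound `N +
|l| ≤ m` excludes aliasing. -/
theorem sum_fejerWeight_mul {m N : ℕ} (hm : m ≠ 0) (l : ℤ) (h : N + |l| ≤ m) :
    ∑ j ∈ Finset.range m, fejerWeight m N j * ((rootOfUnity m ^ j : Circle) : ℂ) ^ l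
      = (N : ℂ)⁻¹ * ∑ a ∈ Finset.range N, ∑ b ∈ Finset.range N,
        if (a : ℤ) + l = b then 1 else 0 := by
  simp only [fejerWeight, mul_assoc, ← Finset.mul_sum, Finset.sum_mul,
    ← zpow_add₀ (Circle.coe_ne_zero _)]
  rw [Finset.sum_comm, mul_inv, mul_comm (m : ℂ)⁻¹, mul_assoc]
  congr 1
  rw [Finset.mul_sum]
  refine Finset.sum_congr rfl fun a ha => ?_
  rw [Finset.sum_comm, Finset.mul_sum]
  refine Finset.sum_congr rfl fun b hb => ?_
  rw [Finset.mem_range] at ha hb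
  rw [sum_rootOfUnity_zpow_of_lt]
  · have : ((a : ℤ) - b + l = 0) ↔ (a : ℤ) + l = b := by omega
    simp only [this]
    split_ifs
    · rw [inv_mul_cancel₀ (by exact_mod_cast hm)]
    · simp
  · have h1 := abs_lt.1 (show |(a : ℤ) - b| < N by rw [abs_lt]; omega)
    have h2 := neg_abs_le l
    have h3 := le_abs_self l
    rw [abs_lt]
    omega

/-- The weights are nonnegative: the double sum is the squared modulus of a geometric sum. -/
theorem norm_fejerWeight (m N j : ℕ) : (‖fejerWeight m N j‖ : ℂ) = fejerWeight m N j := by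
  set D : ℂ := ∑ a ∈ Finset.range N, ((rootOfUnity m ^ j : Circle) : ℂ) ^ a with hD
  have h : fejerWeight m N j = ((((m : ℝ) * N)⁻¹ * ‖D‖ ^ 2 : ℝ) : ℂ) := by
    push_cast
    rw [fejerWeight, ← Complex.mul_conj', hD, map_sum, Finset.sum_mul_sum]
    congr 1
    refine Finset.sum_congr rfl fun a _ => Finset.sum_congr rfl fun b _ => ?_
    rw [map_pow, ← Circle.coe_inv_eq_conj, zpow_sub₀ (Circle.coe_ne_zero _), zpow_natCast,
      zpow_natCast, Circle.coe_inv, inv_pow, div_eq_mul_inv]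
  rw [h, Complex.norm_real, Real.norm_of_nonneg (by positivity)]

theorem sum_norm_fejerWeight {m N : ℕ} (hN : N ≠ 0) (h : N ≤ m) :
    ∑ j ∈ Finset.range m, ‖fejerWeight m N j‖ = 1 := by
  have h1 := sum_fejerWeight_mul (m := m) (N := N) (by omega) 0 (by simpa using h)
  simp only [zpow_zero, mul_one, add_zero, Nat.cast_inj, Finset.sum_ite_eq, Finset.mem_range] at h1
  rw [Finset.sum_congr rfl fun a ha => if_pos (Finset.mem_range.1 ha)] at h1
  have hN' : (N : ℂ) ≠ 0 := by exact_mod_cast hN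
  rw [Finset.sum_const, Finset.card_range, nsmul_eq_mul, mul_one, inv_mul_cancel₀ hN'] at h1
  have h2 : ((∑ j ∈ Finset.range m, ‖fejerWeight m N j‖ : ℝ) : ℂ) = 1 := by
    push_cast
    simp only [norm_fejerWeight, h1]
  exact_mod_cast h2

theorem sum_range_ite_add_eq (N k : ℕ) :
    ∑ a ∈ Finset.range N, ∑ b ∈ Finset.range N, (if (a : ℤ) + k = b then (1 : ℂ) else 0)
      = (N - k : ℕ) := by
  have h : ∀ a b : ℕ, ((a : ℤ) + k = b) ↔ a + k = b := by intro a b; omega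
  simp only [h, Finset.sum_ite_eq, Finset.mem_range]
  rw [Finset.sum_boole]
  congr 1
  rw [← Finset.card_range (N - k)]
  congr 1
  ext a
  simp only [Finset.mem_filter, Finset.mem_range]
  omega

/-- Fejér weights are nonnegative with total mass 1, so the Cesàro mean is a weak limit of convex
combinations of gauge transforms of `A`, each of norm at most `‖A‖`. -/
theorem norm_cesaroMean_le {A : Fock n →L[ℂ] Fock n} (hA : A ∈ toeplitzAlgebra n) {N : ℕ}
    (hN : N ≠ 0) : ‖cesaroMean A N‖ ≤ ‖A‖ := by
  refine norm_le_of_tendsto_entries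
    (T := fun m => gaugeSum (m + N) (fejerWeight (m + N) N) A) (fun m => ?_) fun v w => ?_
  · refine (norm_gaugeSum_le _ _ _).trans (le_of_eq ?_)
    rw [sum_norm_fejerWeight hN (Nat.le_add_left _ _), one_mul]
  · refine tendsto_const_nhds.congr' ?_
    filter_upwards [eventually_ge_atTop (v.length + w.length)] with m hm
    rw [inner_gaugeSum, inner_cesaroMean hA]
    rcases lt_or_ge v.length w.length with h | h
    · simp [inner_basisVec_toeplitz_eq_zero hA h]
    · obtain ⟨k, hk⟩ := Nat.exists_eq_add_of_le' h
      have hm0 : m + N ≠ 0 := by omega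
      rw [sum_fejerWeight_mul hm0]
      · rw [hk, Nat.add_sub_cancel, Nat.cast_add, add_sub_cancel_right, sum_range_ite_add_eq,
          div_eq_inv_mul]
      · have : |(v.length : ℤ) - w.length| ≤ v.length + w.length := by rw [abs_le]; omega
        push_cast
        omega

/-- An element of the Toeplitz algebra belongs to any weakly closed subspace that contains its
homogeneous components. -/
theorem mem_of_homogeneousPart_mem {S : Submodule ℂ (Fock n →L[ℂ] Fock n)}
    (hS : IsWOTClosed (S : Set (Fock n →L[ℂ] Fock n))) {A : Fock n →L[ℂ] Fock n}
    (hA : A ∈ toeplitzAlgebra n) (h : ∀ k, homogeneousPart A k ∈ S) : A ∈ S := by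
  refine hS.mem_of_tendsto_entries (C := ‖A‖) (T := fun N => cesaroMean A (N + 1))
    (fun N => norm_cesaroMean_le hA (Nat.succ_ne_zero N))
    (fun N => S.sum_mem fun k _ => S.smul_mem _ (h k)) fun v w => ?_
  simp only [inner_cesaroMean hA]
  generalize v.length - w.length = k
  have h1 : Tendsto (fun N : ℕ => (((N + 1 - k : ℕ) : ℂ) / ((N + 1 : ℕ) : ℂ))) atTop (𝓝 1) := by
    have h2 : Tendsto (fun N : ℕ => 1 - (k : ℂ) * (1 / ((N : ℂ) + 1))) atTop (𝓝 (1 - k * 0)) :=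
      (tendsto_one_div_add_atTop_nhds_zero_nat.const_mul _).const_sub _
    rw [mul_zero, sub_zero] at h2
    refine h2.congr' ?_
    filter_upwards [eventually_ge_atTop k] with N hN
    have h3 : ((N : ℂ) + 1) ≠ 0 := by exact_mod_cast Nat.succ_ne_zero N
    rw [Nat.cast_sub (by omega)]
    push_cast
    field_simp
  simpa using h1.mul_const ⟪basisVec v, A (basisVec w)⟫_ℂ

/-! ### Vacuum expectations of Voiculescu automorphisms -/

section Vacuum

variable {X : Matrix (Fin (n + 1)) (Fin (n + 1)) ℂ}

theorem inner_vacuum_creationVec (ζ : Fin n → ℂ) (ξ : Fock n) :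
    ⟪vacuum n, creationVec ζ ξ⟫_ℂ = 0 := by
  simp [creationVec, sum_apply, smul_apply, inner_vacuum_creation]

theorem inner_vacuum_vacuum : ⟪vacuum n, vacuum n⟫_ℂ = 1 := by
  rw [vacuum, inner_basisVec, if_pos rfl]

/-- Pair `(x I - L[z])(x I - L[z])⁻¹ = I` with the vacuum, which is orthogonal to the range of
`L[z]`. -/
theorem mul_inner_vacuum_resolvent (hX : IsJUnitary X) (ξ : Fock n) :
    X 0 0 * ⟪vacuum n, voiculescuResolvent X ξ⟫_ℂ = ⟪vacuum n, ξ⟫_ℂ := by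
  have h := congrArg (fun A : Fock n →L[ℂ] Fock n => ⟪vacuum n, A ξ⟫_ℂ)
    (Ring.mul_inverse_cancel _ (isUnit_voiculescu hX))
  simpa [inner_sub_right, inner_smul_right, inner_vacuum_creationVec, voiculescuResolvent] using h

theorem jUnitary_corner_ne_zero (hX : IsJUnitary X) : X 0 0 ≠ 0 := by
  intro h
  have h1 := mul_inner_vacuum_resolvent hX (vacuum n)
  rw [h, zero_mul, inner_vacuum_vacuum] at h1
  exact zero_ne_one h1

theorem inner_vacuum_resolvent (hX : IsJUnitary X) (ξ : Fock n) :
    ⟪vacuum n, voiculescuResolvent X ξ⟫_ℂ = (X 0 0)⁻¹ * ⟪vacuum n, ξ⟫_ℂ := by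
  rw [← mul_inner_vacuum_resolvent hX ξ, inv_mul_cancel_left₀ (jUnitary_corner_ne_zero hX)]

/-- The point of the unit ball at which `Φ_X` evaluates in the vacuum. -/
def ballPoint (X : Matrix (Fin (n + 1)) (Fin (n + 1)) ℂ) (i : Fin n) : ℂ :=
  -X 0 i.succ / X 0 0

theorem inner_vacuum_generator (hX : IsJUnitary X) (i : Fin n) (ξ : Fock n) :
    ⟪vacuum n, voiculescuGenerator X i ξ⟫_ℂ = ballPoint X i * ⟪vacuum n, ξ⟫_ℂ := by
  rw [voiculescuGenerator, mul_apply_eq_comp, inner_vacuum_resolvent hX]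
  simp only [sub_apply, smul_apply, one_apply_eq_self, inner_sub_right, inner_smul_right,
    inner_vacuum_creationVec, ballPoint]
  ring

theorem inner_vacuum_voiculescuVec (hX : IsJUnitary X) (w : List (Fin n)) :
    ⟪vacuum n, voiculescuVec X w⟫_ℂ = (w.map (ballPoint X)).prod * (X 0 0)⁻¹ := by
  induction w with
  | nil =>
    rw [voiculescuVec, List.map_nil, List.prod_nil, one_apply_eq_self, inner_vacuum_resolvent hX,
      inner_vacuum_vacuum, mul_one, List.map_nil, List.prod_nil, one_mul]
  | cons i w ih =>
    have : voiculescuVec X (i :: w) = voiculescuGenerator X i (voiculescuVec X w) := by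
      simp [voiculescuVec]
    rw [this, inner_vacuum_generator hX, ih, List.map_cons, List.prod_cons, mul_assoc]

/-- The vector `U_X* e_∅`, an eigenvector of the adjoints of the creation operators. -/
def eigenVec (hX : IsJUnitary X) : Fock n :=
  ContinuousLinearMap.adjoint (voiculescuUnitary X hX) (vacuum n)

theorem inner_eigenVec_basisVec (hX : IsJUnitary X) (w : List (Fin n)) :
    ⟪eigenVec hX, basisVec w⟫_ℂ = (w.map (ballPoint X)).prod * (X 0 0)⁻¹ := by
  rw [eigenVec, ContinuousLinearMap.adjoint_inner_left, voiculescuUnitary_basisVec,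
    inner_vacuum_voiculescuVec hX]

theorem inner_eigenVec_self_ne_zero (hX : IsJUnitary X) : ⟪eigenVec hX, eigenVec hX⟫_ℂ ≠ 0 := by
  rw [inner_self_ne_zero]
  intro h
  have h1 := inner_eigenVec_basisVec hX []
  rw [h, inner_zero_left, List.map_nil, List.prod_nil, one_mul] at h1
  exact inv_ne_zero (jUnitary_corner_ne_zero hX) h1.symm

/-- The coefficients of the eigenvector are multiplicative under concatenation of words, which is
the eigenvector property. -/
theorem inner_eigenVec_creationWord (hX : IsJUnitary X) (u : List (Fin n)) (ξ : Fock n) :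
    ⟪eigenVec hX, creationWord u ξ⟫_ℂ = (u.map (ballPoint X)).prod * ⟪eigenVec hX, ξ⟫_ℂ := by
  have h : innerSL ℂ (eigenVec hX) ∘L creationWord u
      = (u.map (ballPoint X)).prod • innerSL ℂ (eigenVec hX) := by
    refine clm_ext_basisVec fun w => ?_
    rw [ContinuousLinearMap.comp_apply, smul_apply, innerSL_apply_apply, innerSL_apply_apply,
      creationWord_basisVec, inner_eigenVec_basisVec, inner_eigenVec_basisVec, List.map_append,
      List.prod_append, smul_eq_mul, mul_assoc]
  exact congrArg (fun f : Fock n →L[ℂ] ℂ => f ξ) h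

/-- Moving `U_X` to the vacuum vectors turns the expectation into one at the eigenvector, where each
word operator acts as evaluation at the ball point. This links `Φ_X` to symbols. -/
theorem inner_vacuum_voiculescuMap_homogeneousPart (hX : IsJUnitary X) (A : Fock n →L[ℂ] Fock n)
    (k : ℕ) : ⟪vacuum n, voiculescuMap X hX (homogeneousPart A k) (vacuum n)⟫_ℂ
      = (∑ u ∈ words n k, ⟪basisVec u, A (vacuum n)⟫_ℂ * (u.map (ballPoint X)).prod)
        * ⟪eigenVec hX, eigenVec hX⟫_ℂ := by
  rw [inner_voiculescuMap]
  change ⟪eigenVec hX, homogeneousPart A k (eigenVec hX)⟫_ℂ = _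
  simp only [homogeneousPart, sum_apply, smul_apply, inner_sum, inner_smul_right,
    inner_eigenVec_creationWord, Finset.sum_mul, mul_assoc]

end Vacuum

/-! ### Ball points in every direction -/

/-- Every direction of `ℂⁿ` is realized by the ball point of some `X ∈ U(1,n)`, a reflection of the
indefinite form. -/
theorem exists_ballPoint_eq_smul (ν : Fin n → ℂ) :
    ∃ X : Matrix (Fin (n + 1)) (Fin (n + 1)) ℂ, IsJUnitary X ∧
      ∃ t : ℂ, t ≠ 0 ∧ ∀ i, ballPoint X i = t * ν i := by
  set s : ℝ := ∑ i, ‖ν i‖ ^ 2 with hs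
  have hs0 : 0 ≤ s := Finset.sum_nonneg fun i _ => by positivity
  -- This value makes the indefinite form equal `-a² + s = -1` at the vector `v` below.
  set a : ℝ := √(1 + s) with ha
  have ha2 : a ^ 2 = 1 + s := Real.sq_sqrt (by positivity)
  have ha0 : 0 < a := Real.sqrt_pos.2 (by positivity)
  set v : Fin (n + 1) → ℂ := Fin.cons (a : ℂ) fun i => starRingEnd ℂ (ν i) with hv
  set S := signatureMatrix n with hS
  set P := Matrix.vecMulVec v (star v) with hP
  have hSH : Sᴴ = S := by
    rw [hS, signatureMatrix, Matrix.diagonal_conjTranspose]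
    congr 1
    funext i
    refine Fin.cases ?_ (fun i => ?_) i <;> simp
  have hPH : Pᴴ = P := by
    rw [hP, Matrix.conjTranspose_vecMulVec, star_star]
  have hPSP : P * S * P = -P := by
    have hd : (star v ᵥ* S) ⬝ᵥ v = -1 := by
      have : (star v ᵥ* S) ⬝ᵥ v = ((-a ^ 2 + s : ℝ) : ℂ) := by
        rw [hS, signatureMatrix, dotProduct, Fin.sum_univ_succ, hs]
        simp only [Matrix.vecMul_diagonal, hv, Pi.star_apply, Fin.cons_zero, Fin.cons_succ,
          RCLike.star_def, Complex.conj_conj, Complex.conj_ofReal, mul_one, Complex.mul_conj']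
        push_cast
        ring
      rw [this, ha2]
      push_cast
      ring
    rw [hP, Matrix.vecMulVec_mul, Matrix.vecMulVec_mul_vecMulVec, hd]
    simp [Matrix.vecMulVec_neg]
  -- This matrix sends `v` to `-v` and fixes its complement for the form. Its top row is governed by
  -- `v₀` times the conjugates of the `v_i`, which is why `v` carries the conjugates of `ν`.
  have hX : IsJUnitary (1 + (2 : ℂ) • (P * S)) := by
    rw [IsJUnitary, Matrix.conjTranspose_add, Matrix.conjTranspose_smul,
      Matrix.conjTranspose_mul, hSH, hPH, Matrix.conjTranspose_one]
    have h1 : S * P * S * (P * S) = -(S * P * S) := by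
      calc S * P * S * (P * S) = S * (P * S * P) * S := by simp only [Matrix.mul_assoc]
        _ = -(S * P * S) := by rw [hPSP]; simp
    have h2 : S * (P * S) = S * P * S := (Matrix.mul_assoc _ _ _).symm
    simp only [add_mul, mul_add, one_mul, mul_one, Matrix.smul_mul, Matrix.mul_smul, ← hS, h1, h2]
    simp only [star_ofNat, smul_neg]
    module
  have h00 : (1 + (2 : ℂ) • (P * S)) 0 0 = ((1 - 2 * a ^ 2 : ℝ) : ℂ) := by
    simp [hP, hS, signatureMatrix, Matrix.mul_diagonal, Matrix.vecMulVec_apply, hv]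
    ring
  have h0i : ∀ i : Fin n, (1 + (2 : ℂ) • (P * S)) 0 i.succ = 2 * a * ν i := by
    intro i
    simp [hP, hS, signatureMatrix, Matrix.mul_diagonal, Matrix.vecMulVec_apply, hv,
      (Fin.succ_ne_zero i).symm, mul_assoc]
  refine ⟨_, hX, ((-(2 * a) / (1 - 2 * a ^ 2) : ℝ) : ℂ), ?_, fun i => ?_⟩
  · rw [Complex.ofReal_ne_zero]
    refine div_ne_zero (by linarith) ?_
    rw [ha2]
    linarith
  · rw [ballPoint, h00, h0i]
    push_cast
    ring

/-- A form of degree `k` scales by `t ^ k` along a line, so one ball point with `t ≠ 0` in the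
direction of `μ` suffices. -/
theorem symbol_eq_zero_of_ballPoint {k : ℕ} {a : List (Fin n) → ℂ}
    (h : ∀ X : Matrix (Fin (n + 1)) (Fin (n + 1)) ℂ, IsJUnitary X →
      ∑ u ∈ words n k, a u * (u.map (ballPoint X)).prod = 0) (μ : Fin n → ℂ) :
    ∑ u ∈ words n k, a u * (u.map μ).prod = 0 := by
  obtain ⟨X, hX, t, ht, hμ⟩ := exists_ballPoint_eq_smul μ
  have h1 := h X hX
  have h2 : ∀ u : List (Fin n), (u.map (ballPoint X)).prod = t ^ u.length * (u.map μ).prod := by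
    intro u
    induction u with
    | nil => simp
    | cons i u ih =>
      rw [List.map_cons, List.prod_cons, ih, hμ, List.map_cons, List.prod_cons, List.length_cons]
      ring
  have h3 : t ^ k * ∑ u ∈ words n k, a u * (u.map μ).prod = 0 := by
    rw [← h1, Finset.mul_sum]
    refine Finset.sum_congr rfl fun u hu => ?_
    rw [h2, mem_words.1 hu]
    ring
  exact (mul_eq_zero.1 h3).resolve_left (pow_ne_zero _ ht)

theorem homogeneousPart_zero (A : Fock n →L[ℂ] Fock n) :
    homogeneousPart A 0 = ⟪vacuum n, A (vacuum n)⟫_ℂ • (1 : Fock n →L[ℂ] Fock n) := by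
  have : words n 0 = {[]} := by
    ext w
    rw [mem_words, Finset.mem_singleton, List.length_eq_zero_iff]
  rw [homogeneousPart, this, Finset.sum_singleton]
  simp [creationWord, vacuum]

/-- A weakly closed ideal, invariant under the gauge action, with an element of nonzero vacuum
expectation is everything. -/
theorem eq_top_of_inner_vacuum_ne_zero {J : TwoSidedIdeal (toeplitzAlgebra n)}
    (hclosed : IsWOTClosed (idealOperators J))
    (hinv : ∀ (ω : Circle), ∀ A ∈ idealOperators J, gaugeMap ω A ∈ idealOperators J)
    {A : Fock n →L[ℂ] Fock n} (hA : A ∈ idealOperators J)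
    (h : ⟪vacuum n, A (vacuum n)⟫_ℂ ≠ 0) : J = ⊤ := by
  have h0 := homogeneousPart_mem_of_gaugeMap_mem (S := idealSubmodule J) hclosed
    (mem_idealOperators_iff.1 hA).1 (fun ω => hinv ω A hA) 0
  rw [homogeneousPart_zero, Submodule.smul_mem_iff _ h] at h0
  exact (TwoSidedIdeal.one_mem_iff J).1 (coe_mem_idealOperators.1 h0)

end FockSpace

end


/-! ### The dichotomy -/

theorem theorem7p1 (n : ℕ) (hn : 0 < n)
    (J : TwoSidedIdeal (FockSpace.toeplitzAlgebra n))
    (hclosed : FockSpace.IsWOTClosed (FockSpace.idealOperators J))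
    (hC : FockSpace.commutatorIdeal n ≤ J)
    (hinv : ∀ (X : Matrix (Fin (n + 1)) (Fin (n + 1)) ℂ) (hX : FockSpace.IsJUnitary X),
      FockSpace.voiculescuMap X hX '' FockSpace.idealOperators J = FockSpace.idealOperators J) :
    J = FockSpace.commutatorIdeal n ∨ J = ⊤ := by
  open FockSpace in
  have hmap : ∀ (X : Matrix (Fin (n + 1)) (Fin (n + 1)) ℂ) (hX : IsJUnitary X),
      ∀ A ∈ idealOperators J, voiculescuMap X hX A ∈ idealOperators J :=
    fun X hX A hA => hinv X hX ▸ Set.mem_image_of_mem _ hA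
  have hpart : ∀ A ∈ idealOperators J, ∀ k, homogeneousPart A k ∈ idealOperators J :=
    fun A hA k => homogeneousPart_mem_of_gaugeMap_mem (S := idealSubmodule J) hclosed
      (mem_idealOperators_iff.1 hA).1 (fun ω => hmap _ _ A hA) k
  -- Do the symbols of all homogeneous parts of elements of `J` vanish at all ball points?
  by_cases h : ∀ A ∈ idealOperators J, ∀ (k : ℕ) (X : Matrix (Fin (n + 1)) (Fin (n + 1)) ℂ),
      IsJUnitary X →
      ∑ u ∈ words n k, inner ℂ (basisVec u) (A (vacuum n)) * (u.map (ballPoint X)).prod = 0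
  · refine Or.inl (le_antisymm (fun A hA => ?_) hC)
    have hA' := coe_mem_idealOperators.2 hA
    refine coe_mem_idealOperators.1 ?_
    exact mem_of_homogeneousPart_mem (S := idealSubmodule (commutatorIdeal n))
      isWOTClosed_commutatorIdeal A.2 fun k =>
        sum_creationWord_mem_commutatorIdeal _ _ (symbol_eq_zero_of_ballPoint (h _ hA' k))
  · push Not at h
    obtain ⟨A, hA, k, X, hX, hne⟩ := h
    -- The homogeneous part lies in `J`, so its image under `Φ_X` does too; that image has nonzero
    -- vacuum expectation.
    refine Or.inr (eq_top_of_inner_vacuum_ne_zero hclosed (fun ω => hmap _ _)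
      (hmap X hX _ (hpart A hA k)) ?_)
    rw [inner_vacuum_voiculescuMap_homogeneousPart]
    exact mul_ne_zero hne (inner_eigenVec_self_ne_zero hX)
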